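/- Consider an $M/M/N$ queue ($N\ge 1$) with Poisson arrivals of rate $\lambda>0$, FIFO service of delayed customers, and exponential service times, under Random routing: an arriving customer that finds idle servers is assigned to one of them chosen uniformly at random, and joins an infinite queue if all servers are busy. One tagged server works at rate $\mu_1$ and the other $N-1$ servers work at rate $\mu$, where $\mu>\lambda/N$ and $\mu_1>\underline{\mu}_1:=(\lambda-(N-1)\mu)^+$. The Markov chain that records the set of busy servers and the number of waiting customers then has exactly one stationary distribution; let $I(\mu_1)$ be the stationary probability that the tagged server is idle. For fixed $N,\lambda,\mu$, the function $I$ is three times continuously differentiable on $(\underline{\mu}_1,\infty)$, and its derivatives with respect to $\mu_1$ satisfy: (a) There is a threshold $\mu_1^\dagger\in[\underline{\mu}_1,\infty)$ such that $I''(\mu_1)>0$ for $\underline{\mu}_1<\mu_1<\mu_1^\dagger$, and $I''(\mu_1)<0$ for $\mu_1^\dagger<\mu_1<\infty$. (In particular $I$ is strictly convex on $(\underline{\mu}_1,\mu_1^\dagger)$ and strictly concave on $(\mu_1^\dagger,\infty)$; the first interval may be empty.) (b) For every $\mu_1>\underline{\mu}_1$, if $I''(\mu_1)>0$ then $I'''(\mu_1)<0$.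 -/

import Mathlib

/-- A state of an `M/M/N` system: the set `busy` of busy servers and the number `queue` of waiting
customers. Customers wait only when all servers are busy. -/
@[ext]
structure MMNState (N : ℕ) where
  busy : Finset (Fin N)
  queue : ℕ
  work_conserving : queue ≠ 0 → busy = Finset.univ

namespace MMNState

/-- An arriving customer starts service at server `i`. -/
def route {N : ℕ} (s : MMNState N) (i : Fin N) : MMNState N where
  busy := insert i s.busy
  queue := s.queue
  work_conserving := fun h => by rw [s.work_conserving h]; exact Finset.insert_eq_of_mem (Finset.mem_univ i)

/-- An arriving customer who finds all servers busy joins the queue. -/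
def enqueue {N : ℕ} (s : MMNState N) : MMNState N where
  busy := Finset.univ
  queue := s.queue + 1
  work_conserving := fun _ => rfl

/-- Server `i` completes a service: it becomes idle if nobody is waiting, and otherwise immediately
takes the next waiting customer. -/
def complete {N : ℕ} (s : MMNState N) (i : Fin N) : MMNState N where
  busy := if s.queue = 0 then s.busy.erase i else Finset.univ
  queue := s.queue - 1
  work_conserving := fun h => if_neg (by omega)

end MMNState

open Classical in
/-- Rate of the transition from `s` to `s'` in the `M/M/N` system with arrival rate `lam`, in which
server `i` works at rate `r i`. Random routing: an arriving customer goes to one of the idle servers,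
chosen uniformly at random; if there is none, the customer joins the queue. -/
noncomputable def mmnRate {N : ℕ} (lam : ℝ) (r : Fin N → ℝ) (s s' : MMNState N) : ℝ :=
  (if s.busy = Finset.univ then (if s' = s.enqueue then lam else 0)
    else ∑ i ∈ s.busyᶜ, if s' = s.route i then lam / (s.busyᶜ.card : ℝ) else 0)
  + ∑ i ∈ s.busy, if s' = s.complete i then r i else 0

/-- `p` is a stationary distribution of the continuous-time Markov chain on `S` with transition rates
`q`: a probability distribution for which in every state the total flow in equals the total flow
out. -/
structure IsStationaryDistribution {S : Type*} (q : S → S → ℝ) (p : S → ℝ) : Prop where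
  nonneg : ∀ s, 0 ≤ p s
  hasSum_one : HasSum p 1
  balance : ∀ s, HasSum (fun s' => p s' * q s' s) (p s * ∑' s', q s s')

/-- The stationary distribution of a continuous-time Markov chain (meaningful if there is exactly
one). -/
noncomputable def stationaryDistribution {S : Type*} (q : S → S → ℝ) : S → ℝ :=
  Classical.epsilon (IsStationaryDistribution q)

open Classical in
/-- Steady-state probability that server `i` is idle in the `M/M/N` system with Random routing. -/
noncomputable def mmnIdle {N : ℕ} (lam : ℝ) (r : Fin N → ℝ) (i : Fin N) : ℝ :=
  ∑' s : MMNState N, if i ∈ s.busy then 0 else stationaryDistribution (mmnRate lam r) s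

/-- Service rates when the tagged server `i` works at rate `x` and all others at rate `mu`. -/
def taggedRates {N : ℕ} (i : Fin N) (mu x : ℝ) : Fin N → ℝ :=
  Function.update (fun _ => mu) i x

/-- Idle time of the tagged server `i` as a function of its own rate `x`. -/
noncomputable def taggedIdle {N : ℕ} (lam mu : ℝ) (i : Fin N) (x : ℝ) : ℝ :=
  mmnIdle lam (taggedRates i mu x) i

/-- The smallest rate of the tagged server, `(lam - (N - 1) mu)⁺`, above which the system is stable. -/
noncomputable def taggedRateInf (N : ℕ) (lam mu : ℝ) : ℝ :=
  max (lam - ((N : ℝ) - 1) * mu) 0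

/-!
Under Random routing the chain is reversible: the weight `|Bᶜ|! ∏_{j ∈ B} lam / r j` of a busy set
`B`, continued geometrically along the queue, is in detailed balance with the transition rates.
Uniqueness holds because the pointwise minimum of two stationary distributions is again invariant,
so that the set where the first is at most the second is closed under predecessors.

Separating the busy sets which contain the tagged server from the others shows that its idle
probability is `t (t + g) / (t² + (b + g) t + d)`, where `t` is the distance of its rate from the
infimum and `b, d > 0`, `g ≥ 0` do not depend on the rate. The second derivative of this function is
`-2 C / (t² + (b + g) t + d)³` with a cubic `C` which is strictly increasing for `t ≥ 0` and
eventually positive. Moreover `C' / 3` is the positive numerator of the first derivative, which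
forces the third derivative to be negative wherever `C ≤ 0`.
-/

section Chain

theorem eq_of_le_of_hasSum {ι α : Type*} [AddCommGroup α] [PartialOrder α] [IsOrderedAddMonoid α]
    [TopologicalSpace α] [IsTopologicalAddGroup α] [OrderClosedTopology α] {f g : ι → α} {a : α}
    (hle : f ≤ g) (hf : HasSum f a) (hg : HasSum g a) : f = g :=
  eq_of_le_of_not_lt hle fun hlt => (hasSum_strict_mono hf hg hlt).false

/-- Detailed balance of the weights `w` with the transition rates `q`: the flows between any two
states cancel. The weights need not be normalised. -/
def DetailedBalance {S : Type*} (q : S → S → ℝ) (w : S → ℝ) : Prop :=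
  ∀ s t, w s * q s t = w t * q t s

/-- Irreducibility of a continuous-time Markov chain with transition rates `q`: every state can be
reached from every state through transitions of positive rate. -/
def IrreducibleRates {S : Type*} (q : S → S → ℝ) : Prop :=
  ∀ s s', Relation.ReflTransGen (fun a b => 0 < q a b) s s'

variable {S : Type*} {q : S → S → ℝ} {p p' w : S → ℝ}

theorem DetailedBalance.irreducibleRates (h : DetailedBalance q w) (hw : ∀ s, 0 < w s) {s₀ : S}
    (hreach : ∀ s, Relation.ReflTransGen (fun a b => 0 < q a b) s₀ s) : IrreducibleRates q := by
  have hsymm : Std.Symm fun a b => 0 < q a b :=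
    ⟨fun a b hab => (mul_pos_iff_of_pos_left (hw b)).1 (h a b ▸ mul_pos (hw a) hab)⟩
  exact fun s s' => (Std.Symm.symm _ _ (hreach s)).trans (hreach s')

theorem DetailedBalance.isStationaryDistribution (h : DetailedBalance q w)
    (hqs : ∀ s, Summable (q s)) (hw : ∀ s, 0 ≤ w s) {W : ℝ} (hsum : HasSum w W) (hW : W ≠ 0) :
    IsStationaryDistribution q fun s => w s / W where
  nonneg s := div_nonneg (hw s) (hsum.nonneg hw)
  hasSum_one := div_self hW ▸ hsum.div_const W
  balance s := by
    have hflow : ∀ s', w s' / W * q s' s = w s / W * q s s' := fun s' => by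
      rw [div_mul_eq_mul_div, h s' s, ← div_mul_eq_mul_div]
    simpa only [hflow] using (hqs s).hasSum.mul_left (w s / W)

theorem hasSum_inflow_of_inflow_le_outflow (hq : ∀ s s', 0 ≤ q s s') (hqs : ∀ s, Summable (q s))
    (hw : ∀ s, 0 ≤ w s) (hflow : Summable fun s => w s * ∑' s', q s s')
    (hle : ∀ s, ∑' s', w s' * q s' s ≤ w s * ∑' s', q s s') (s : S) :
    HasSum (fun s' => w s' * q s' s) (w s * ∑' s', q s s') := by
  have hprod : Summable fun z : S × S => w z.1 * q z.1 z.2 :=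
    (summable_prod_of_nonneg fun z => mul_nonneg (hw z.1) (hq z.1 z.2)).2
      ⟨fun s => (hqs s).mul_left (w s), by simpa only [tsum_mul_left] using hflow⟩
  have htotal : ∑' s, ∑' s', w s' * q s' s = ∑' s, w s * ∑' s', q s s' := by
    rw [Summable.tsum_comm (f := fun s' s => w s' * q s' s) hprod]
    simp only [tsum_mul_left]
  have heq : (fun s => ∑' s', w s' * q s' s) = fun s => w s * ∑' s', q s s' :=
    eq_of_le_of_hasSum hle (htotal ▸ hprod.prod_symm.prod.hasSum) hflow.hasSum
  exact congrFun heq s ▸ (hprod.prod_symm.prod_factor s).hasSum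

namespace IsStationaryDistribution

theorem summable_outflow (hp : IsStationaryDistribution q p) (hq : ∀ s s', 0 ≤ q s s') {C : ℝ}
    (hC : ∀ s, ∑' s', q s s' ≤ C) : Summable fun s => p s * ∑' s', q s s' :=
  (hp.hasSum_one.summable.mul_right C).of_nonneg_of_le
    (fun s => mul_nonneg (hp.nonneg s) (tsum_nonneg (hq s)))
    fun s => mul_le_mul_of_nonneg_left (hC s) (hp.nonneg s)

theorem hasSum_inflow_min (hq : ∀ s s', 0 ≤ q s s') (hqs : ∀ s, Summable (q s))
    (hp : IsStationaryDistribution q p) (hp' : IsStationaryDistribution q p')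
    (hflow : Summable fun s => p s * ∑' s', q s s') (s : S) :
    HasSum (fun s' => min (p s') (p' s') * q s' s) (min (p s) (p' s) * ∑' s', q s s') := by
  have hmin : ∀ s, 0 ≤ min (p s) (p' s) := fun s => le_min (hp.nonneg s) (hp'.nonneg s)
  have hin : ∀ s, Summable fun s' => min (p s') (p' s') * q s' s := fun s =>
    (hp.balance s).summable.of_nonneg_of_le (fun s' => mul_nonneg (hmin s') (hq s' s))
      fun s' => mul_le_mul_of_nonneg_right (min_le_left _ _) (hq s' s)
  have hout : ∀ s, 0 ≤ ∑' s', q s s' := fun s => tsum_nonneg (hq s)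
  refine hasSum_inflow_of_inflow_le_outflow (w := fun s => min (p s) (p' s)) hq hqs hmin
    (hflow.of_nonneg_of_le (fun s => mul_nonneg (hmin s) (hout s))
      fun s => mul_le_mul_of_nonneg_right (min_le_left _ _) (hout s)) (fun s => ?_) s
  rw [min_mul_of_nonneg _ _ (hout s)]
  exact le_min
    (hasSum_le (fun s' => mul_le_mul_of_nonneg_right (min_le_left _ _) (hq s' s))
      (hin s).hasSum (hp.balance s))
    (hasSum_le (fun s' => mul_le_mul_of_nonneg_right (min_le_right _ _) (hq s' s))
      (hin s).hasSum (hp'.balance s))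

theorem le_of_rate_pos (hq : ∀ s s', 0 ≤ q s s') (hqs : ∀ s, Summable (q s))
    (hp : IsStationaryDistribution q p) (hp' : IsStationaryDistribution q p')
    (hflow : Summable fun s => p s * ∑' s', q s s') {s s' : S} (hss' : 0 < q s s')
    (hle : p s' ≤ p' s') : p s ≤ p' s := by
  have hmin := hasSum_inflow_min hq hqs hp hp' hflow s'
  rw [min_eq_left hle] at hmin
  have heq := eq_of_le_of_hasSum
    (fun s => mul_le_mul_of_nonneg_right (min_le_left (p s) (p' s)) (hq s s')) hmin (hp.balance s')
  exact min_eq_left_iff.1 (mul_right_cancel₀ hss'.ne' (congrFun heq s))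

theorem eq_of_irreducibleRates (hq : ∀ s s', 0 ≤ q s s') (hqs : ∀ s, Summable (q s))
    (hirr : IrreducibleRates q) (hp : IsStationaryDistribution q p)
    (hp' : IsStationaryDistribution q p') (hflow : Summable fun s => p s * ∑' s', q s s') :
    p = p' := by
  by_cases hex : ∃ s, p s ≤ p' s
  · obtain ⟨s₀, hs₀⟩ := hex
    refine eq_of_le_of_hasSum (fun s => ?_) hp.hasSum_one hp'.hasSum_one
    induction hirr s s₀ using Relation.ReflTransGen.head_induction_on with
    | refl => exact hs₀
    | head hrate _ ih => exact le_of_rate_pos hq hqs hp hp' hflow hrate ih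
  · push Not at hex
    exact (eq_of_le_of_hasSum (fun s => (hex s).le) hp'.hasSum_one hp.hasSum_one).symm

theorem stationaryDistribution_eq (hp : IsStationaryDistribution q p)
    (huniq : ∃! p, IsStationaryDistribution q p) : stationaryDistribution q = p :=
  huniq.unique (Classical.epsilon_spec huniq.exists) hp

end IsStationaryDistribution

end Chain

namespace MMNState

variable {N : ℕ}

/-- The state with busy set `B` and no waiting customers. -/
def ofBusy (B : Finset (Fin N)) : MMNState N where
  busy := B
  queue := 0
  work_conserving := fun h => absurd rfl h

/-- The state with all servers busy and `n` waiting customers. -/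
def ofQueue (N n : ℕ) : MMNState N where
  busy := Finset.univ
  queue := n
  work_conserving := fun _ => rfl

/-- The decomposition of the state space into the states without waiting customers and those with
`n + 1` waiting customers, used to sum over all states. -/
def equivSum (N : ℕ) : Finset (Fin N) ⊕ ℕ ≃ MMNState N where
  toFun := Sum.elim ofBusy fun n => ofQueue N (n + 1)
  invFun s := if s.queue = 0 then Sum.inl s.busy else Sum.inr (s.queue - 1)
  left_inv := by rintro (B | n) <;> simp [ofBusy, ofQueue]
  right_inv s := by
    by_cases h : s.queue = 0
    · ext1 <;> simp [h, ofBusy]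
    · ext1
      · simp [h, ofQueue, s.work_conserving h]
      · simp only [h, if_false, Sum.elim_inr, ofQueue]
        omega

theorem hasSum_of_ofQueue {α : Type*} [AddCommMonoid α] [TopologicalSpace α] [ContinuousAdd α]
    {f : MMNState N → α} {a : α} (h : HasSum (fun n => f (ofQueue N (n + 1))) a) :
    HasSum f (∑ B, f (ofBusy B) + a) :=
  (equivSum N).hasSum_iff.1 <| HasSum.sum (hasSum_fintype fun B => f (ofBusy B)) h

theorem queue_eq_zero {s : MMNState N} (h : s.busy ≠ Finset.univ) : s.queue = 0 :=
  not_not.1 fun hq => h (s.work_conserving hq)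

theorem eq_route_iff_eq_complete {s s' : MMNState N} (h : s.busy ≠ Finset.univ) (i : Fin N) :
    i ∉ s.busy ∧ s' = s.route i ↔ i ∈ s'.busy ∧ s = s'.complete i := by
  have hq := queue_eq_zero h
  constructor
  · rintro ⟨hi, rfl⟩
    refine ⟨by simp [route], ?_⟩
    ext1 <;> simp [complete, route, hq, hi]
  · rintro ⟨hi, rfl⟩
    have hq' : s'.queue = 0 := by
      by_contra hne
      exact h (by simp [complete, hne])
    refine ⟨by simp [complete, hq'], ?_⟩
    ext1 <;> simp [complete, route, hq', hi]

theorem eq_enqueue_iff_eq_complete {s s' : MMNState N} (h : s.busy = Finset.univ) {i : Fin N}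
    (hi : i ∈ s'.busy) : s' = s.enqueue ↔ s = s'.complete i := by
  constructor
  · rintro rfl
    ext1 <;> simp [complete, enqueue, h]
  · intro hs
    have hq : s'.queue ≠ 0 := by
      intro hq
      have : i ∉ s.busy := by simp [hs, complete, hq]
      exact this (h ▸ Finset.mem_univ i)
    ext1
    · simp [enqueue, s'.work_conserving hq]
    · simp only [hs, enqueue, complete]
      omega

end MMNState

section Rates

open Classical in
/-- Rate at which an arrival takes an `M/M/N` system with Random routing from `s` to `s'`. -/
noncomputable def mmnArrivalRate {N : ℕ} (lam : ℝ) (s s' : MMNState N) : ℝ :=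
  if s.busy = Finset.univ then (if s' = s.enqueue then lam else 0)
    else ∑ i ∈ s.busyᶜ, if s' = s.route i then lam / (s.busyᶜ.card : ℝ) else 0

open Classical in
/-- Rate at which a service completion takes an `M/M/N` system from `s` to `s'`. -/
noncomputable def mmnServiceRate {N : ℕ} (r : Fin N → ℝ) (s s' : MMNState N) : ℝ :=
  ∑ i ∈ s.busy, if s' = s.complete i then r i else 0

variable {N : ℕ} {lam : ℝ} {r : Fin N → ℝ} {s : MMNState N}

theorem mmnRate_eq_add (lam : ℝ) (r : Fin N → ℝ) (s s' : MMNState N) :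
    mmnRate lam r s s' = mmnArrivalRate lam s s' + mmnServiceRate r s s' := rfl

open Classical in
theorem mmnArrivalRate_of_busy_eq_univ (h : s.busy = Finset.univ) (lam : ℝ) (s' : MMNState N) :
    mmnArrivalRate lam s s' = if s' = s.enqueue then lam else 0 :=
  if_pos h

open Classical in
theorem mmnArrivalRate_of_busy_ne_univ (h : s.busy ≠ Finset.univ) (lam : ℝ) (s' : MMNState N) :
    mmnArrivalRate lam s s' =
      ∑ i ∈ s.busyᶜ, if s' = s.route i then lam / (s.busyᶜ.card : ℝ) else 0 :=
  if_neg h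

theorem card_compl_busy_ne_zero (h : s.busy ≠ Finset.univ) : (s.busyᶜ.card : ℝ) ≠ 0 := by
  simpa using h

theorem hasSum_mmnArrivalRate (lam : ℝ) (s : MMNState N) : HasSum (mmnArrivalRate lam s) lam := by
  classical
  by_cases h : s.busy = Finset.univ
  · simpa only [funext (mmnArrivalRate_of_busy_eq_univ h lam)] using hasSum_ite_eq s.enqueue lam
  · have hsum : HasSum (mmnArrivalRate lam s) (∑ _i ∈ s.busyᶜ, lam / (s.busyᶜ.card : ℝ)) := by
      rw [funext (mmnArrivalRate_of_busy_ne_univ h lam)]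
      exact hasSum_sum fun _ _ => hasSum_ite_eq _ _
    rwa [Finset.sum_const, nsmul_eq_mul, mul_div_cancel₀ _ (card_compl_busy_ne_zero h)] at hsum

theorem hasSum_mmnServiceRate (r : Fin N → ℝ) (s : MMNState N) :
    HasSum (mmnServiceRate r s) (∑ i ∈ s.busy, r i) := by
  classical
  exact hasSum_sum fun _ _ => hasSum_ite_eq _ _

theorem hasSum_mmnRate (lam : ℝ) (r : Fin N → ℝ) (s : MMNState N) :
    HasSum (mmnRate lam r s) (lam + ∑ i ∈ s.busy, r i) :=
  (hasSum_mmnArrivalRate lam s).add (hasSum_mmnServiceRate r s)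

theorem mmnArrivalRate_nonneg (hlam : 0 ≤ lam) (s s' : MMNState N) :
    0 ≤ mmnArrivalRate lam s s' := by
  unfold mmnArrivalRate
  split_ifs
  · exact hlam
  · exact le_rfl
  · exact Finset.sum_nonneg fun i _ => by split_ifs <;> positivity

theorem mmnServiceRate_nonneg (hr : ∀ i, 0 ≤ r i) (s s' : MMNState N) :
    0 ≤ mmnServiceRate r s s' :=
  Finset.sum_nonneg fun i _ => by split_ifs; exacts [hr i, le_rfl]

theorem mmnRate_nonneg (hlam : 0 ≤ lam) (hr : ∀ i, 0 ≤ r i) (s s' : MMNState N) :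
    0 ≤ mmnRate lam r s s' :=
  add_nonneg (mmnArrivalRate_nonneg hlam s s') (mmnServiceRate_nonneg hr s s')

theorem mmnRate_enqueue_pos (hlam : 0 < lam) (hr : ∀ i, 0 ≤ r i) (h : s.busy = Finset.univ) :
    0 < mmnRate lam r s s.enqueue := by
  refine add_pos_of_pos_of_nonneg ?_ (mmnServiceRate_nonneg hr _ _)
  simpa only [if_pos h, if_true] using hlam

theorem mmnRate_route_pos (hlam : 0 < lam) (hr : ∀ i, 0 ≤ r i) {i : Fin N} (hi : i ∉ s.busy) :
    0 < mmnRate lam r s (s.route i) := by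
  refine add_pos_of_pos_of_nonneg ?_ (mmnServiceRate_nonneg hr _ _)
  have h : s.busy ≠ Finset.univ := fun h => hi (h ▸ Finset.mem_univ i)
  have hmem : i ∈ s.busyᶜ := Finset.mem_compl.2 hi
  have hcard : 0 < s.busyᶜ.card := Finset.card_pos.2 ⟨i, hmem⟩
  rw [if_neg h]
  refine Finset.sum_pos' (fun j _ => by split_ifs <;> positivity) ⟨i, hmem, ?_⟩
  rw [if_pos rfl]
  positivity

theorem reachable_from_empty (hlam : 0 < lam) (hr : ∀ i, 0 ≤ r i) (s : MMNState N) :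
    Relation.ReflTransGen (fun a b => 0 < mmnRate lam r a b) (MMNState.ofBusy ∅) s := by
  classical
  have hbusy : ∀ B : Finset (Fin N), Relation.ReflTransGen (fun a b => 0 < mmnRate lam r a b)
      (MMNState.ofBusy ∅) (MMNState.ofBusy B) := by
    intro B
    induction B using Finset.induction_on with
    | empty => exact .refl
    | insert i B hi ih => exact ih.tail (mmnRate_route_pos hlam hr (s := .ofBusy B) hi)
  have hqueue : ∀ n, Relation.ReflTransGen (fun a b => 0 < mmnRate lam r a b)
      (MMNState.ofBusy ∅) (MMNState.ofQueue N n) := by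
    intro n
    induction n with
    | zero => exact hbusy Finset.univ
    | succ n ih => exact ih.tail (mmnRate_enqueue_pos hlam hr (s := .ofQueue N n) rfl)
  obtain ⟨B | n, rfl⟩ := (MMNState.equivSum N).surjective s
  exacts [hbusy B, hqueue (n + 1)]

end Rates

section ProductForm

/-- Product-form weight of the state with busy set `B` and an empty queue, normalised so that the
empty system has weight `N!`. -/
noncomputable def mmnBusyWeight {N : ℕ} (lam : ℝ) (r : Fin N → ℝ) (B : Finset (Fin N)) : ℝ :=
  (Bᶜ.card.factorial : ℝ) * ∏ i ∈ B, lam / r i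

/-- Product-form weight of a state: the unnormalised stationary distribution of the `M/M/N` system
with Random routing. -/
noncomputable def mmnWeight {N : ℕ} (lam : ℝ) (r : Fin N → ℝ) (s : MMNState N) : ℝ :=
  mmnBusyWeight lam r s.busy * (lam / ∑ i, r i) ^ s.queue

/-- Sum of the product-form weights of all states, with the contribution of the nonempty queues
written as the value of a geometric series; it is that sum only in the stable case
`lam < ∑ i, r i`. -/
noncomputable def mmnTotalWeight {N : ℕ} (lam : ℝ) (r : Fin N → ℝ) : ℝ :=
  ∑ B, mmnBusyWeight lam r B + mmnBusyWeight lam r Finset.univ * (lam / (∑ i, r i - lam))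

variable {N : ℕ} {lam : ℝ} {r : Fin N → ℝ} {s : MMNState N}

theorem mmnBusyWeight_pos (hlam : 0 < lam) (hr : ∀ i, 0 < r i) (B : Finset (Fin N)) :
    0 < mmnBusyWeight lam r B :=
  mul_pos (by positivity) (Finset.prod_pos fun i _ => div_pos hlam (hr i))

theorem mmnWeight_pos (hlam : 0 < lam) (hr : ∀ i, 0 < r i) (hsum : 0 < ∑ i, r i)
    (s : MMNState N) : 0 < mmnWeight lam r s :=
  mul_pos (mmnBusyWeight_pos hlam hr _) (pow_pos (div_pos hlam hsum) _)

theorem mmnTotalWeight_pos (hlam : 0 < lam) (hr : ∀ i, 0 < r i) (hstab : lam < ∑ i, r i) :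
    0 < mmnTotalWeight lam r :=
  add_pos_of_nonneg_of_pos (Finset.sum_nonneg fun B _ => (mmnBusyWeight_pos hlam hr B).le)
    (mul_pos (mmnBusyWeight_pos hlam hr _) (div_pos hlam (sub_pos.2 hstab)))

theorem mmnBusyWeight_insert {B : Finset (Fin N)} {i : Fin N} (hi : i ∉ B) :
    mmnBusyWeight lam r (insert i B) * (Bᶜ.card : ℝ) = mmnBusyWeight lam r B * (lam / r i) := by
  have hcard : Bᶜ.card = (insert i B)ᶜ.card + 1 := by
    rw [Finset.compl_insert, Finset.card_erase_add_one (Finset.mem_compl.2 hi)]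
  rw [mmnBusyWeight, mmnBusyWeight, Finset.prod_insert hi, hcard, Nat.factorial_succ]
  push_cast
  ring

theorem mmnWeight_enqueue (hsum : ∑ i, r i ≠ 0) (h : s.busy = Finset.univ) :
    mmnWeight lam r s.enqueue * ∑ i, r i = mmnWeight lam r s * lam := by
  simp only [mmnWeight, MMNState.enqueue, h, pow_succ]
  field_simp

theorem mmnWeight_route {i : Fin N} (hr : r i ≠ 0) (hi : i ∉ s.busy) :
    mmnWeight lam r (s.route i) * r i = mmnWeight lam r s * (lam / (s.busyᶜ.card : ℝ)) := by
  have h : s.busy ≠ Finset.univ := fun h => hi (h ▸ Finset.mem_univ i)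
  have hcard := card_compl_busy_ne_zero h
  have hinsert := mmnBusyWeight_insert (lam := lam) (r := r) hi
  simp only [mmnWeight, MMNState.route, MMNState.queue_eq_zero h, pow_zero, mul_one]
  field_simp at hinsert ⊢
  exact hinsert

theorem mmnWeight_mul_mmnArrivalRate (hr : ∀ i, r i ≠ 0) (hsum : ∑ i, r i ≠ 0)
    (s s' : MMNState N) :
    mmnWeight lam r s * mmnArrivalRate lam s s' = mmnWeight lam r s' * mmnServiceRate r s' s := by
  classical
  by_cases h : s.busy = Finset.univ
  · have hservice : mmnServiceRate r s' s = ∑ i ∈ s'.busy, if s' = s.enqueue then r i else 0 :=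
      Finset.sum_congr rfl fun i hi =>
        if_congr (MMNState.eq_enqueue_iff_eq_complete h hi).symm rfl rfl
    rw [hservice, mmnArrivalRate_of_busy_eq_univ h]
    split_ifs with hs'
    · subst hs'
      exact (mmnWeight_enqueue hsum h).symm
    · simp only [Finset.sum_const_zero, mul_zero]
  · have harrival : mmnArrivalRate lam s s' =
        ∑ i with i ∉ s.busy ∧ s' = s.route i, lam / (s.busyᶜ.card : ℝ) := by
      rw [mmnArrivalRate_of_busy_ne_univ h, ← Finset.sum_filter]
      congr 1
      ext i
      simp
    have hservice : mmnServiceRate r s' s =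
        ∑ i with i ∉ s.busy ∧ s' = s.route i, r i := by
      rw [mmnServiceRate, ← Finset.sum_filter]
      congr 1
      ext i
      simp [MMNState.eq_route_iff_eq_complete h]
    rw [harrival, hservice, Finset.mul_sum, Finset.mul_sum]
    refine Finset.sum_congr rfl fun i hi => ?_
    obtain ⟨hidle, rfl⟩ := (Finset.mem_filter.1 hi).2
    exact (mmnWeight_route (hr i) hidle).symm

theorem detailedBalance_mmnWeight (hr : ∀ i, r i ≠ 0) (hsum : ∑ i, r i ≠ 0) :
    DetailedBalance (mmnRate lam r) (mmnWeight lam r) := by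
  intro s s'
  rw [mmnRate_eq_add, mmnRate_eq_add, mul_add, mul_add, mmnWeight_mul_mmnArrivalRate hr hsum s s',
    mmnWeight_mul_mmnArrivalRate hr hsum s' s, add_comm]

theorem irreducibleRates_mmnRate (hlam : 0 < lam) (hr : ∀ i, 0 < r i) (hsum : 0 < ∑ i, r i) :
    IrreducibleRates (mmnRate lam r) :=
  (detailedBalance_mmnWeight (fun i => (hr i).ne') hsum.ne').irreducibleRates
    (mmnWeight_pos hlam hr hsum) (reachable_from_empty hlam fun i => (hr i).le)

theorem hasSum_mmnWeight (hlam : 0 ≤ lam) (hstab : lam < ∑ i, r i) :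
    HasSum (mmnWeight lam r) (mmnTotalWeight lam r) := by
  have hsum : 0 < ∑ i, r i := hlam.trans_lt hstab
  have hne : ∑ i, r i - lam ≠ 0 := (sub_pos.2 hstab).ne'
  have htail : HasSum (fun n => mmnWeight lam r (.ofQueue N (n + 1)))
      (mmnBusyWeight lam r Finset.univ * (lam / (∑ i, r i - lam))) := by
    have hgeom := (hasSum_geometric_of_lt_one (div_nonneg hlam hsum.le)
      ((div_lt_one hsum).2 hstab)).mul_left (mmnBusyWeight lam r Finset.univ * (lam / ∑ i, r i))
    convert! hgeom using 1
    · funext n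
      simp only [mmnWeight, MMNState.ofQueue, pow_succ]
      ring
    · rw [one_sub_div hsum.ne', inv_div]
      field_simp
  simpa only [mmnTotalWeight, mmnWeight, MMNState.ofBusy, pow_zero, mul_one] using
    MMNState.hasSum_of_ofQueue htail

theorem isStationaryDistribution_mmnWeight (hlam : 0 < lam) (hr : ∀ i, 0 < r i)
    (hstab : lam < ∑ i, r i) :
    IsStationaryDistribution (mmnRate lam r) fun s => mmnWeight lam r s / mmnTotalWeight lam r :=
  have hsum : 0 < ∑ i, r i := hlam.trans hstab
  (detailedBalance_mmnWeight (fun i => (hr i).ne') hsum.ne').isStationaryDistribution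
    (fun s => (hasSum_mmnRate lam r s).summable) (fun s => (mmnWeight_pos hlam hr hsum s).le)
    (hasSum_mmnWeight hlam.le hstab) (mmnTotalWeight_pos hlam hr hstab).ne'

theorem existsUnique_isStationaryDistribution_mmnRate (hlam : 0 < lam) (hr : ∀ i, 0 < r i)
    (hstab : lam < ∑ i, r i) : ∃! p, IsStationaryDistribution (mmnRate lam r) p := by
  have hnonneg := mmnRate_nonneg hlam.le fun i => (hr i).le
  have hbound : ∀ s, ∑' s', mmnRate lam r s s' ≤ lam + ∑ i, r i := fun s => by
    rw [(hasSum_mmnRate lam r s).tsum_eq, add_le_add_iff_left]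
    exact Finset.sum_le_univ_sum_of_nonneg fun i => (hr i).le
  refine ⟨_, isStationaryDistribution_mmnWeight hlam hr hstab, fun p hp => ?_⟩
  exact hp.eq_of_irreducibleRates hnonneg (fun s => (hasSum_mmnRate lam r s).summable)
    (irreducibleRates_mmnRate hlam hr (hlam.trans hstab))
    (isStationaryDistribution_mmnWeight hlam hr hstab) (hp.summable_outflow hnonneg hbound)

theorem mmnIdle_eq (hlam : 0 < lam) (hr : ∀ i, 0 < r i) (hstab : lam < ∑ i, r i) (i : Fin N) :
    mmnIdle lam r i = (∑ B with i ∉ B, mmnBusyWeight lam r B) / mmnTotalWeight lam r := by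
  classical
  have htail : HasSum (fun n => if i ∈ (MMNState.ofQueue N (n + 1)).busy then 0 else
      mmnWeight lam r (.ofQueue N (n + 1)) / mmnTotalWeight lam r) 0 := by
    simpa only [MMNState.ofQueue, Finset.mem_univ, if_true] using hasSum_zero
  have hsum := (MMNState.hasSum_of_ofQueue (f := fun s => if i ∈ s.busy then 0 else
    mmnWeight lam r s / mmnTotalWeight lam r) htail).tsum_eq
  rw [mmnIdle, (isStationaryDistribution_mmnWeight hlam hr hstab).stationaryDistribution_eq
    (existsUnique_isStationaryDistribution_mmnRate hlam hr hstab), hsum]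
  simp only [MMNState.ofBusy, mmnWeight, pow_zero, mul_one, add_zero, Finset.sum_div,
    Finset.sum_filter, ite_not, ite_div, zero_div]

end ProductForm

section TaggedServer

/-- Steady-state idle probability of server `i` in the `M/M/N` system with Random routing, as a
function of its own rate `x`; each other server `j` has rate `r j`. -/
noncomputable def serverIdle {N : ℕ} (lam : ℝ) (r : Fin N → ℝ) (i : Fin N) (x : ℝ) : ℝ :=
  mmnIdle lam (Function.update r i x) i

/-- The smallest rate of server `i` above which the `M/M/N` system is stable when the other servers
have rates `r`. -/
noncomputable def serverRateInf {N : ℕ} (lam : ℝ) (r : Fin N → ℝ) (i : Fin N) : ℝ :=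
  max (lam - ∑ j ∈ Finset.univ.erase i, r j) 0

variable {N : ℕ} {lam x : ℝ} {r : Fin N → ℝ} {i : Fin N}

theorem update_pos (hr : ∀ j ≠ i, 0 < r j) (hx : 0 < x) (j : Fin N) :
    0 < Function.update r i x j := by
  rcases eq_or_ne j i with rfl | hj
  · simpa using hx
  · simpa [hj] using hr j hj

theorem sum_update (r : Fin N → ℝ) (i : Fin N) (x : ℝ) :
    ∑ j, Function.update r i x j = x + ∑ j ∈ Finset.univ.erase i, r j := by
  rw [Finset.sum_update_of_mem (Finset.mem_univ i), Finset.sdiff_singleton_eq_erase]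

theorem pos_of_serverRateInf_lt (hx : serverRateInf lam r i < x) : 0 < x :=
  (le_max_right _ _).trans_lt hx

theorem lt_sum_update_of_serverRateInf_lt (hx : serverRateInf lam r i < x) :
    lam < ∑ j, Function.update r i x j := by
  rw [sum_update, ← sub_lt_iff_lt_add]
  exact (le_max_left _ _).trans_lt hx

theorem mmnBusyWeight_update_of_notMem {B : Finset (Fin N)} (hi : i ∉ B) (x : ℝ) :
    mmnBusyWeight lam (Function.update r i x) B = mmnBusyWeight lam r B := by
  unfold mmnBusyWeight
  congr 1
  exact Finset.prod_congr rfl fun j hj =>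
    by rw [Function.update_of_ne (ne_of_mem_of_not_mem hj hi)]

theorem mmnBusyWeight_update_of_mem {B : Finset (Fin N)} (hi : i ∈ B) (x : ℝ) :
    mmnBusyWeight lam (Function.update r i x) B =
      mmnBusyWeight lam (Function.update r i 1) B / x := by
  have hprod : ∀ y, ∏ j ∈ B, lam / Function.update r i y j =
      lam / y * ∏ j ∈ B.erase i, lam / r j := fun y => by
    rw [← Finset.mul_prod_erase B _ hi, Function.update_self]
    congr 1
    exact Finset.prod_congr rfl fun j hj => by
      rw [Function.update_of_ne (Finset.ne_of_mem_erase hj)]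
  rw [mmnBusyWeight, mmnBusyWeight, hprod, hprod]
  ring

theorem mmnTotalWeight_update (lam : ℝ) (r : Fin N → ℝ) (i : Fin N) (x : ℝ) :
    mmnTotalWeight lam (Function.update r i x) =
      ∑ B with i ∉ B, mmnBusyWeight lam r B +
      (∑ B with i ∈ B, mmnBusyWeight lam (Function.update r i 1) B) / x +
      mmnBusyWeight lam (Function.update r i 1) Finset.univ / x *
        (lam / (x - (lam - ∑ j ∈ Finset.univ.erase i, r j))) := by
  have hbusy : ∑ B with i ∈ B, mmnBusyWeight lam (Function.update r i x) B =
      (∑ B with i ∈ B, mmnBusyWeight lam (Function.update r i 1) B) / x := by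
    rw [Finset.sum_div]
    exact Finset.sum_congr rfl fun B hB =>
      mmnBusyWeight_update_of_mem (Finset.mem_filter.1 hB).2 x
  have hidle : ∑ B with i ∉ B, mmnBusyWeight lam (Function.update r i x) B =
      ∑ B with i ∉ B, mmnBusyWeight lam r B :=
    Finset.sum_congr rfl fun B hB => mmnBusyWeight_update_of_notMem (Finset.mem_filter.1 hB).2 x
  rw [mmnTotalWeight, ← Finset.sum_filter_not_add_sum_filter _ (fun B => i ∈ B), hidle, hbusy,
    mmnBusyWeight_update_of_mem (Finset.mem_univ i), sum_update, sub_sub_eq_add_sub]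

theorem serverIdle_eq (hlam : 0 < lam) (hr : ∀ j ≠ i, 0 < r j) (hx : serverRateInf lam r i < x) :
    serverIdle lam r i x =
      (∑ B with i ∉ B, mmnBusyWeight lam r B) / mmnTotalWeight lam (Function.update r i x) := by
  rw [serverIdle, mmnIdle_eq hlam (update_pos hr (pos_of_serverRateInf_lt hx))
    (lt_sum_update_of_serverRateInf_lt hx)]
  congr 1
  exact Finset.sum_congr rfl fun B hB => mmnBusyWeight_update_of_notMem (Finset.mem_filter.1 hB).2 x

theorem div_add_div_add_div_mul_div {K : Type*} [Field K] {a x y : K} (ha : a ≠ 0) (hx : x ≠ 0)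
    (hy : y ≠ 0) (k l m : K) :
    a / (a + k / x + l / x * (m / y)) = x * y / (x * y + k / a * y + l * m / a) := by
  have hdenom : x * y + k / a * y + l * m / a = x * y / a * (a + k / x + l / x * (m / y)) := by
    field_simp
  have hxy : x * y / a ≠ 0 := div_ne_zero (mul_ne_zero hx hy) ha
  rw [hdenom, ← mul_div_mul_left a _ hxy, div_mul_cancel₀ _ ha]

theorem exists_serverIdle_eq_div (hlam : 0 < lam) (hr : ∀ j ≠ i, 0 < r j) :
    ∃ b e c : ℝ, 0 < b ∧ 0 < e ∧ serverRateInf lam r i = max c 0 ∧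
      ∀ x, serverRateInf lam r i < x →
        serverIdle lam r i x = x * (x - c) / (x * (x - c) + b * (x - c) + e) := by
  have hweight : ∀ B, 0 < mmnBusyWeight lam (Function.update r i 1) B :=
    mmnBusyWeight_pos hlam (update_pos hr one_pos)
  have hidle : 0 < ∑ B with i ∉ B, mmnBusyWeight lam r B := Finset.sum_pos
    (fun B hB => mmnBusyWeight_update_of_notMem (Finset.mem_filter.1 hB).2 1 ▸ hweight B)
    ⟨∅, by simp⟩
  have hbusy : 0 < ∑ B with i ∈ B, mmnBusyWeight lam (Function.update r i 1) B :=
    Finset.sum_pos (fun B _ => hweight B) ⟨Finset.univ, by simp⟩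
  refine ⟨_, _, lam - ∑ j ∈ Finset.univ.erase i, r j, div_pos hbusy hidle,
    div_pos (mul_pos (hweight Finset.univ) hlam) hidle, rfl, fun x hx => ?_⟩
  have hxc : x - (lam - ∑ j ∈ Finset.univ.erase i, r j) ≠ 0 :=
    (sub_pos.2 ((le_max_left _ _).trans_lt hx)).ne'
  rw [serverIdle_eq hlam hr hx, mmnTotalWeight_update,
    div_add_div_add_div_mul_div hidle.ne' (pos_of_serverRateInf_lt hx).ne' hxc]

end TaggedServer

section IdleRatio

theorem exists_sign_change_of_strictMonoOn {f : ℝ → ℝ} {a : ℝ} (hf : StrictMonoOn f (Set.Ici a))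
    (hpos : ∃ t, a ≤ t ∧ 0 ≤ f t) :
    ∃ z, a ≤ z ∧ (∀ t, a ≤ t → t < z → f t < 0) ∧ ∀ t, z < t → 0 < f t := by
  have hbdd : BddBelow {t | a ≤ t ∧ 0 ≤ f t} := ⟨a, fun t ht => ht.1⟩
  refine ⟨sInf {t | a ≤ t ∧ 0 ≤ f t}, le_csInf hpos fun t ht => ht.1, fun t hat htz => ?_,
    fun t hzt => ?_⟩
  · by_contra! hft
    exact htz.not_ge (csInf_le hbdd ⟨hat, hft⟩)
  · obtain ⟨u, ⟨hau, hfu⟩, hut⟩ := exists_lt_of_csInf_lt hpos hzt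
    exact hfu.trans_lt (hf hau (hau.trans hut.le) hut)

theorem eqOn_iteratedDeriv_succ {𝕜 F : Type*} [NontriviallyNormedField 𝕜] [NormedAddCommGroup F]
    [NormedSpace 𝕜 F] {f g g' : 𝕜 → F} {U : Set 𝕜} {n : ℕ} (hU : IsOpen U)
    (hf : Set.EqOn (iteratedDeriv n f) g U) (hg : ∀ x ∈ U, HasDerivAt g (g' x) x) :
    Set.EqOn (iteratedDeriv (n + 1) f) g' U := fun x hx => by
  rw [iteratedDeriv_succ, (hf.eventuallyEq_of_mem (hU.mem_nhds hx)).deriv_eq, (hg x hx).deriv]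

/-- Denominator of the idle probability, in terms of the distance `t` of the rate of the tagged
server from its infimum. -/
def idleDenom (b g d t : ℝ) : ℝ :=
  t ^ 2 + (b + g) * t + d

/-- The idle probability of the tagged server, in terms of the distance `t` of its rate from the
infimum. -/
noncomputable def idleRatio (b g d t : ℝ) : ℝ :=
  t * (t + g) / idleDenom b g d t

/-- Numerator of the first derivative of `idleRatio` over the square of the denominator. -/
def idleQuadratic (b g d t : ℝ) : ℝ :=
  b * t ^ 2 + 2 * d * t + d * g

/-- Numerator of the second derivative of `idleRatio` over the cube of the denominator, divided by
`-2`. -/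
def idleCubic (b g d t : ℝ) : ℝ :=
  b * t ^ 3 + 3 * d * t ^ 2 + 3 * d * g * t + d * (g * (b + g) - d)

variable {b g d t : ℝ}

theorem idleDenom_pos (hb : 0 ≤ b) (hg : 0 ≤ g) (hd : 0 < d) (ht : 0 ≤ t) :
    0 < idleDenom b g d t := by
  unfold idleDenom
  positivity

theorem idleQuadratic_pos (hb : 0 ≤ b) (hg : 0 ≤ g) (hd : 0 < d) (ht : 0 < t) :
    0 < idleQuadratic b g d t := by
  unfold idleQuadratic
  positivity

theorem idleCubic_strictMonoOn (hb : 0 < b) (hg : 0 ≤ g) (hd : 0 ≤ d) :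
    StrictMonoOn (idleCubic b g d) (Set.Ici 0) := by
  intro s (hs : 0 ≤ s) t _ hst
  have hcubic : b * s ^ 3 < b * t ^ 3 := by gcongr
  have hquadratic : 3 * d * s ^ 2 ≤ 3 * d * t ^ 2 := by gcongr
  have hlinear : 3 * d * g * s ≤ 3 * d * g * t := by gcongr
  unfold idleCubic
  linarith

theorem exists_sign_change_idleCubic (hb : 0 < b) (hg : 0 ≤ g) (hd : 0 ≤ d) :
    ∃ z, 0 ≤ z ∧ (∀ t, 0 ≤ t → t < z → idleCubic b g d t < 0) ∧
      ∀ t, z < t → 0 < idleCubic b g d t := by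
  refine exists_sign_change_of_strictMonoOn (idleCubic_strictMonoOn hb hg hd)
    ⟨d + 1, by positivity, ?_⟩
  have hexpand : idleCubic b g d (d + 1) = b * (d + 1) ^ 3 + 3 * d ^ 3 + 5 * d ^ 2 + 3 * d
      + 3 * d * g * (d + 1) + d * g * (b + g) := by
    unfold idleCubic
    ring
  rw [hexpand]
  positivity

theorem hasDerivAt_idleDenom (b g d t : ℝ) :
    HasDerivAt (idleDenom b g d) (2 * t + (b + g)) t := by
  refine HasDerivAt.congr_deriv
    ((((hasDerivAt_id t).pow 2).add ((hasDerivAt_id t).const_mul (b + g))).add_const d) ?_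
  norm_num

theorem hasDerivAt_idleQuadratic (b g d t : ℝ) :
    HasDerivAt (idleQuadratic b g d) (2 * (b * t + d)) t := by
  refine HasDerivAt.congr_deriv ((((hasDerivAt_id t).pow 2).const_mul b).add
    ((hasDerivAt_id t).const_mul (2 * d)) |>.add_const (d * g)) ?_
  norm_num
  ring

theorem hasDerivAt_idleCubic (b g d t : ℝ) :
    HasDerivAt (idleCubic b g d) (3 * idleQuadratic b g d t) t := by
  refine HasDerivAt.congr_deriv ((((hasDerivAt_id t).pow 3).const_mul b).add
    (((hasDerivAt_id t).pow 2).const_mul (3 * d)) |>.add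
    ((hasDerivAt_id t).const_mul (3 * d * g)) |>.add_const (d * (g * (b + g) - d))) ?_
  norm_num [idleQuadratic]
  ring

theorem hasDerivAt_idleRatio (h : idleDenom b g d t ≠ 0) :
    HasDerivAt (idleRatio b g d) (idleQuadratic b g d t / idleDenom b g d t ^ 2) t := by
  refine HasDerivAt.congr_deriv (((hasDerivAt_id t).mul ((hasDerivAt_id t).add_const g)).div
    (hasDerivAt_idleDenom b g d t) h) ?_
  congr 1
  simp only [Pi.mul_apply, id_eq, idleDenom, idleQuadratic]
  ring

theorem hasDerivAt_idleQuadratic_div (h : idleDenom b g d t ≠ 0) :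
    HasDerivAt (fun t => idleQuadratic b g d t / idleDenom b g d t ^ 2)
      (-2 * idleCubic b g d t / idleDenom b g d t ^ 3) t := by
  refine HasDerivAt.congr_deriv ((hasDerivAt_idleQuadratic b g d t).div
    ((hasDerivAt_idleDenom b g d t).pow 2) (pow_ne_zero 2 h)) ?_
  have hcubic : idleCubic b g d t =
      idleQuadratic b g d t * (2 * t + (b + g)) - (b * t + d) * idleDenom b g d t := by
    simp only [idleCubic, idleQuadratic, idleDenom]
    ring
  rw [hcubic]
  push_cast
  field_simp
  ring

theorem hasDerivAt_idleCubic_div (h : idleDenom b g d t ≠ 0) :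
    HasDerivAt (fun t => -2 * idleCubic b g d t / idleDenom b g d t ^ 3)
      (6 * ((2 * t + (b + g)) * idleCubic b g d t - idleDenom b g d t * idleQuadratic b g d t) /
        idleDenom b g d t ^ 4) t := by
  refine HasDerivAt.congr_deriv (((hasDerivAt_idleCubic b g d t).const_mul (-2)).div
    ((hasDerivAt_idleDenom b g d t).pow 3) (pow_ne_zero 3 h)) ?_
  push_cast
  field_simp
  ring

theorem iteratedDeriv_two_idleRatio (hb : 0 ≤ b) (hg : 0 ≤ g) (hd : 0 < d) :
    Set.EqOn (iteratedDeriv 2 (idleRatio b g d))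
      (fun t => -2 * idleCubic b g d t / idleDenom b g d t ^ 3) (Set.Ioi 0) := by
  have hne : ∀ t ∈ Set.Ioi (0 : ℝ), idleDenom b g d t ≠ 0 := fun t ht =>
    (idleDenom_pos hb hg hd (le_of_lt ht)).ne'
  have hzero : Set.EqOn (iteratedDeriv 0 (idleRatio b g d)) (idleRatio b g d) (Set.Ioi 0) :=
    fun t _ => congrFun iteratedDeriv_zero t
  have hone := eqOn_iteratedDeriv_succ isOpen_Ioi hzero fun t ht => hasDerivAt_idleRatio (hne t ht)
  exact eqOn_iteratedDeriv_succ isOpen_Ioi hone fun t ht =>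
    hasDerivAt_idleQuadratic_div (hne t ht)

theorem iteratedDeriv_two_idleRatio_pos_iff (hb : 0 ≤ b) (hg : 0 ≤ g) (hd : 0 < d) (ht : 0 < t) :
    0 < iteratedDeriv 2 (idleRatio b g d) t ↔ idleCubic b g d t < 0 := by
  rw [iteratedDeriv_two_idleRatio hb hg hd ht,
    div_pos_iff_of_pos_right (pow_pos (idleDenom_pos hb hg hd ht.le) 3)]
  constructor <;> intro <;> linarith

theorem iteratedDeriv_two_idleRatio_neg_iff (hb : 0 ≤ b) (hg : 0 ≤ g) (hd : 0 < d) (ht : 0 < t) :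
    iteratedDeriv 2 (idleRatio b g d) t < 0 ↔ 0 < idleCubic b g d t := by
  rw [iteratedDeriv_two_idleRatio hb hg hd ht,
    div_lt_iff₀ (pow_pos (idleDenom_pos hb hg hd ht.le) 3), zero_mul]
  constructor <;> intro <;> linarith

theorem iteratedDeriv_three_idleRatio_neg (hb : 0 ≤ b) (hg : 0 ≤ g) (hd : 0 < d) (ht : 0 < t)
    (hcubic : idleCubic b g d t ≤ 0) : iteratedDeriv 3 (idleRatio b g d) t < 0 := by
  have hdenom := idleDenom_pos hb hg hd ht.le
  rw [eqOn_iteratedDeriv_succ isOpen_Ioi (iteratedDeriv_two_idleRatio hb hg hd)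
    (fun t ht => hasDerivAt_idleCubic_div (idleDenom_pos hb hg hd (le_of_lt ht)).ne') ht]
  have hle : (2 * t + (b + g)) * idleCubic b g d t ≤ 0 :=
    mul_nonpos_of_nonneg_of_nonpos (by positivity) hcubic
  have hlt : 0 < idleDenom b g d t * idleQuadratic b g d t :=
    mul_pos hdenom (idleQuadratic_pos hb hg hd ht)
  exact div_neg_of_neg_of_pos (by linarith) (pow_pos hdenom 4)

theorem contDiffOn_idleRatio {n : WithTop ℕ∞} (hb : 0 ≤ b) (hg : 0 ≤ g) (hd : 0 < d) :
    ContDiffOn ℝ n (idleRatio b g d) (Set.Ici 0) := by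
  refine ContDiffOn.div (by fun_prop) ?_ fun t ht => (idleDenom_pos hb hg hd ht).ne'
  unfold idleDenom
  fun_prop

end IdleRatio

theorem exists_serverIdle_eq_idleRatio {N : ℕ} {i : Fin N} {lam : ℝ} {r : Fin N → ℝ}
    (hlam : 0 < lam) (hr : ∀ j ≠ i, 0 < r j) :
    ∃ b g d : ℝ, 0 < b ∧ 0 ≤ g ∧ 0 < d ∧
      Set.EqOn (serverIdle lam r i) (fun x => idleRatio b g d (x - serverRateInf lam r i))
        (Set.Ioi (serverRateInf lam r i)) := by
  obtain ⟨b, e, c, hb, he, hinf, hidle⟩ := exists_serverIdle_eq_div hlam hr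
  rcases le_total 0 c with h | h
  · rw [max_eq_left h] at hinf
    refine ⟨b, c, e, hb, h, he, fun x hx => ?_⟩
    simp only [hidle x hx, hinf, idleRatio, idleDenom]
    congr 1 <;> ring
  · rw [max_eq_right h] at hinf
    refine ⟨b, -c, e + b * -c, hb, neg_nonneg.2 h,
      add_pos_of_pos_of_nonneg he (mul_nonneg hb.le (neg_nonneg.2 h)), fun x hx => ?_⟩
    simp only [hidle x hx, hinf, idleRatio, idleDenom]
    congr 1 <;> ring

theorem taggedRateInf_eq_serverRateInf {N : ℕ} (i : Fin N) (lam mu : ℝ) :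
    taggedRateInf N lam mu = serverRateInf lam (fun _ => mu) i := by
  rw [taggedRateInf, serverRateInf, Finset.sum_const, Finset.card_erase_of_mem (Finset.mem_univ i),
    Finset.card_univ, Fintype.card_fin, nsmul_eq_mul, Nat.cast_pred i.pos]

theorem theorem3_general {N : ℕ} (i : Fin N) {lam : ℝ} {r : Fin N → ℝ} (hlam : 0 < lam)
    (hr : ∀ j ≠ i, 0 < r j) :
    (∀ x, serverRateInf lam r i < x →
      ∃! p, IsStationaryDistribution (mmnRate lam (Function.update r i x)) p) ∧
    ContDiffOn ℝ 3 (serverIdle lam r i) (Set.Ioi (serverRateInf lam r i)) ∧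
    (∃ xd, serverRateInf lam r i ≤ xd ∧
      (∀ x, serverRateInf lam r i < x → x < xd → 0 < iteratedDeriv 2 (serverIdle lam r i) x) ∧
      (∀ x, xd < x → iteratedDeriv 2 (serverIdle lam r i) x < 0)) ∧
    (∀ x, serverRateInf lam r i < x → 0 < iteratedDeriv 2 (serverIdle lam r i) x →
      iteratedDeriv 3 (serverIdle lam r i) x < 0) := by
  obtain ⟨b, g, d, hb, hg, hd, hidle⟩ := exists_serverIdle_eq_idleRatio hlam hr
  set m := serverRateInf lam r i
  have hderiv : ∀ n x, m < x →
      iteratedDeriv n (serverIdle lam r i) x = iteratedDeriv n (idleRatio b g d) (x - m) :=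
    fun n x hx => (hidle.iteratedDeriv_of_isOpen isOpen_Ioi n hx).trans
      (congrFun (iteratedDeriv_comp_sub_const n (idleRatio b g d) m) x)
  refine ⟨fun x hx => ?_, ?_, ?_, fun x hx hpos => ?_⟩
  · exact existsUnique_isStationaryDistribution_mmnRate hlam
      (update_pos hr (pos_of_serverRateInf_lt hx)) (lt_sum_update_of_serverRateInf_lt hx)
  · exact ((contDiffOn_idleRatio hb.le hg hd).comp (by fun_prop)
      fun x (hx : m < x) => sub_nonneg.2 hx.le).congr hidle
  · obtain ⟨z, hz, hneg, hpos⟩ := exists_sign_change_idleCubic hb hg hd.le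
    refine ⟨m + z, le_add_of_nonneg_right hz, fun x hx hxz => ?_, fun x hxz => ?_⟩
    · rw [hderiv 2 x hx, iteratedDeriv_two_idleRatio_pos_iff hb.le hg hd (sub_pos.2 hx)]
      exact hneg _ (sub_pos.2 hx).le (sub_lt_iff_lt_add'.2 hxz)
    · have hx : m < x := (le_add_of_nonneg_right hz).trans_lt hxz
      rw [hderiv 2 x hx, iteratedDeriv_two_idleRatio_neg_iff hb.le hg hd (sub_pos.2 hx)]
      exact hpos _ (lt_sub_iff_add_lt'.2 hxz)
  · have ht := sub_pos.2 hx
    rw [hderiv 2 x hx, iteratedDeriv_two_idleRatio_pos_iff hb.le hg hd ht] at hpos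
    exact hderiv 3 x hx ▸ iteratedDeriv_three_idleRatio_neg hb.le hg hd ht hpos.le

theorem theorem3 (N : ℕ) (i : Fin N) (lam mu : ℝ) (hlam : 0 < lam) (hmu : lam / (N : ℝ) < mu) :
    (∀ x : ℝ, taggedRateInf N lam mu < x →
      ∃! p : MMNState N → ℝ, IsStationaryDistribution (mmnRate lam (taggedRates i mu x)) p) ∧
    ContDiffOn ℝ 3 (taggedIdle lam mu i) (Set.Ioi (taggedRateInf N lam mu)) ∧
    (∃ xd : ℝ, taggedRateInf N lam mu ≤ xd ∧
      (∀ x : ℝ, taggedRateInf N lam mu < x → x < xd →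
        0 < iteratedDeriv 2 (taggedIdle lam mu i) x) ∧
      (∀ x : ℝ, xd < x → iteratedDeriv 2 (taggedIdle lam mu i) x < 0)) ∧
    (∀ x : ℝ, taggedRateInf N lam mu < x →
      0 < iteratedDeriv 2 (taggedIdle lam mu i) x →
        iteratedDeriv 3 (taggedIdle lam mu i) x < 0) := by
  rw [taggedRateInf_eq_serverRateInf i]
  exact theorem3_general i hlam fun _ _ => (div_nonneg hlam.le N.cast_nonneg).trans_lt hmu
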